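/- Let $\Omega$ be a field and $n\ge 1$ an integer. For a Lie algebra $L$ over $\Omega$, let $L\wedge L$ be the Lie algebra over $\Omega$ generated by symbols $m\wedge l$ ($m,l\in L$) subject to the following relations, for all $\alpha\in\Omega$ and $m,m',l,l'\in L$: * $\alpha(m\wedge l)=\alpha m\wedge l=m\wedge\alpha l$; * $(m+m')\wedge l=m\wedge l+m'\wedge l$ and $m\wedge(l+l')=m\wedge l+m\wedge l'$; * $[m,m']\wedge l=m\wedge[m',l]-m'\wedge[m,l]$; * $m\wedge[l,l']=[l',m]\wedge l-[l,m]\wedge l'$; * $[m\wedge l,\,m'\wedge l']=-[l,m]\wedge[m',l']$; * $m\wedge m=0$. Let $\mathcal M(L)$ be the kernel of the homomorphism $L\wedge L\to[L,L]$, $m\wedge l\mapsto[m,l]$, let $\mathcal M_0(L)\subseteq\mathcal M(L)$ be the linear span of all $m\wedge l$ with $[m,l]=0$, and let $B(L)=\mathcal M(L)/\mathcal M_0(L)$ be the Bogomolov multiplier of $L$. (1) There is a finite-dimensional nilpotent Lie algebra $L$ over $\Omega$ of nilpotency class exactly $2$ such that $B(L)$ is finite-dimensional and $\dim_\Omega B(L)\ge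 n$. (2) More explicitly, let $d>4n$. A freest generalized Heisenberg Lie algebra $L_d$ is a Lie algebra over $\Omega$ that is minimally generated by $d$ elements (some $d$ elements generate it and no fewer do) and satisfies $[L_d,L_d]=Z(L_d)$ and $\dim[L_d,L_d]=\tfrac12d(d-1)$. Such a Lie algebra exists, and for every such $L_d$ and all $x_1,\dots,x_d$ generating it, if $M$ is the ideal of $L_d$ generated by $$[x_{4k+1},x_{4k+2}]+[x_{4k+3},x_{4k+4}],\qquad 0\le k\le n-1,$$ then $L=L_d/M$ has all the properties in (1). -/

import Mathlib

universe u

noncomputable section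

namespace LieBogomolov

section ExteriorSquare

variable (Ω : Type u) [Field Ω] (L : Type u) [LieRing L] [LieAlgebra Ω L]

/-- The free Lie algebra over `Ω` on the symbols `m ∧ n`, one for each pair of elements of `L`. -/
abbrev FreeWedge : Type u := FreeLieAlgebra Ω (L × L)

variable {L} in
/-- The free generator `m ∧ n`. -/
abbrev sym (m n : L) : FreeWedge Ω L := FreeLieAlgebra.of Ω (m, n)

/-- The defining relations of the exterior square of a Lie algebra; `Rel Ω L a b` is the
relation `a = b`. -/
inductive Rel : FreeWedge Ω L → FreeWedge Ω L → Prop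
  | smul_left (α : Ω) (m n : L) : Rel (α • sym Ω m n) (sym Ω (α • m) n)
  | smul_right (α : Ω) (m n : L) : Rel (α • sym Ω m n) (sym Ω m (α • n))
  | add_left (m m' n : L) : Rel (sym Ω (m + m') n) (sym Ω m n + sym Ω m' n)
  | add_right (m n n' : L) : Rel (sym Ω m (n + n')) (sym Ω m n + sym Ω m n')
  | lie_left (m m' n : L) : Rel (sym Ω ⁅m, m'⁆ n) (sym Ω m ⁅m', n⁆ - sym Ω m' ⁅m, n⁆)
  | lie_right (m n n' : L) : Rel (sym Ω m ⁅n, n'⁆) (sym Ω ⁅n', m⁆ n - sym Ω ⁅n, m⁆ n')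
  | lie_lie (m n m' n' : L) : Rel ⁅sym Ω m n, sym Ω m' n'⁆ (-sym Ω ⁅n, m⁆ ⁅m', n'⁆)
  | self (m : L) : Rel (sym Ω m m) 0

/-- The ideal of the free Lie algebra generated by the relations. -/
def relIdeal : LieIdeal Ω (FreeWedge Ω L) :=
  LieSubmodule.lieSpan Ω (FreeWedge Ω L) {c | ∃ a b, Rel Ω L a b ∧ c = a - b}

/-- The exterior square `L ∧ L`, as the Lie algebra presented by the symbols `m ∧ n` and the
relations `Rel`. -/
abbrev ExteriorSquare : Type u := FreeWedge Ω L ⧸ relIdeal Ω L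

variable {L} in
/-- The element `m ∧ n` of the exterior square. -/
def wedge (m n : L) : ExteriorSquare Ω L :=
  LieSubmodule.Quotient.mk (N := relIdeal Ω L) (sym Ω m n)

/-- The derived subalgebra `[L, L]`. -/
abbrev derived : LieIdeal Ω L := LieAlgebra.derivedSeries Ω L 1

variable {L} in
theorem lie_mem_derived (m n : L) : ⁅m, n⁆ ∈ derived Ω L := by
  have h : derived Ω L = ⁅(⊤ : LieIdeal Ω L), (⊤ : LieIdeal Ω L)⁆ := by
    simp [LieAlgebra.derivedSeriesOfIdeal_succ]
  rw [h]
  exact LieSubmodule.lie_mem_lie (LieSubmodule.mem_top m) (LieSubmodule.mem_top n)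

/-- The homomorphism from the free Lie algebra on the symbols `m ∧ n` to `[L, L]` with
`m ∧ n ↦ [m, n]`. -/
def freeCommutatorMap : FreeWedge Ω L →ₗ⁅Ω⁆ derived Ω L :=
  FreeLieAlgebra.lift Ω fun p => ⟨⁅p.1, p.2⁆, lie_mem_derived Ω p.1 p.2⟩

variable {L} in
theorem freeCommutatorMap_sym (m n : L) :
    freeCommutatorMap Ω L (sym Ω m n) = ⟨⁅m, n⁆, lie_mem_derived Ω m n⟩ :=
  FreeLieAlgebra.lift_of_apply _ _

variable {L} in
theorem coe_freeCommutatorMap_sym (m n : L) :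
    (freeCommutatorMap Ω L (sym Ω m n) : L) = ⁅m, n⁆ := by
  rw [freeCommutatorMap_sym]

variable {L} in
theorem freeCommutatorMap_rel {a b : FreeWedge Ω L} (h : Rel Ω L a b) :
    freeCommutatorMap Ω L a = freeCommutatorMap Ω L b := by
  apply Subtype.ext
  cases h <;>
    simp only [map_add, map_sub, map_neg, map_zero, map_smul, LieHom.map_lie,
      LieSubmodule.coe_add, LieSubmodule.coe_sub, LieSubmodule.coe_neg, LieSubmodule.coe_zero,
      LieSubmodule.coe_smul, LieSubmodule.coe_bracket, LieIdeal.coe_bracket_of_module,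
      coe_freeCommutatorMap_sym, smul_lie, lie_smul, add_lie, lie_add, lie_self]
  case lie_left m m' n => exact lie_lie m m' n
  case lie_right m n n' =>
    rw [leibniz_lie m n n', ← lie_skew n m, ← lie_skew m n', lie_neg, lie_skew, neg_lie,
      sub_neg_eq_add]
    exact add_comm _ _
  case lie_lie m n m' n' => rw [← lie_skew m n, neg_lie]

theorem relIdeal_le_ker : relIdeal Ω L ≤ (freeCommutatorMap Ω L).ker := by
  refine LieSubmodule.lieSpan_le.mpr ?_
  rintro _ ⟨a, b, h, rfl⟩
  rw [SetLike.mem_coe, LieHom.mem_ker, map_sub, freeCommutatorMap_rel Ω h, sub_self]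

/-- The homomorphism `L ∧ L → [L, L]` with `m ∧ n ↦ [m, n]`. -/
def commutatorMap : ExteriorSquare Ω L →ₗ⁅Ω⁆ derived Ω L :=
  { (relIdeal Ω L).toSubmodule.liftQ (freeCommutatorMap Ω L : FreeWedge Ω L →ₗ[Ω] derived Ω L)
      (fun _ hx => (LieHom.mem_ker).mp (relIdeal_le_ker Ω L hx)) with
    map_lie' := by
      intro x y
      induction x using Submodule.Quotient.induction_on
      induction y using Submodule.Quotient.induction_on
      exact LieHom.map_lie (freeCommutatorMap Ω L) _ _ }

variable {L} in
theorem commutatorMap_wedge (m n : L) :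
    commutatorMap Ω L (wedge Ω m n) = ⟨⁅m, n⁆, lie_mem_derived Ω m n⟩ :=
  freeCommutatorMap_sym Ω m n

/-- `M(L)`, the kernel of `L ∧ L → [L, L]`, as a subspace of `L ∧ L`. -/
def schurMultiplier : Submodule Ω (ExteriorSquare Ω L) := (commutatorMap Ω L).ker.toSubmodule

/-- `M₀(L)`, the subspace of `L ∧ L` generated by all `m ∧ n` with `[m, n] = 0`. -/
def commutingPart : Submodule Ω (ExteriorSquare Ω L) :=
  Submodule.span Ω {w | ∃ m n : L, ⁅m, n⁆ = 0 ∧ w = wedge Ω m n}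

theorem commutingPart_le_schurMultiplier : commutingPart Ω L ≤ schurMultiplier Ω L := by
  refine Submodule.span_le.mpr ?_
  rintro _ ⟨m, n, h, rfl⟩
  change wedge Ω m n ∈ (commutatorMap Ω L).ker
  rw [LieHom.mem_ker, commutatorMap_wedge]
  exact Subtype.ext h

/-- The Bogomolov multiplier `B(L) = M(L) / M₀(L)`, as a vector space over `Ω`. -/
abbrev BogomolovMultiplier : Type u :=
  schurMultiplier Ω L ⧸ (commutingPart Ω L).submoduleOf (schurMultiplier Ω L)

end ExteriorSquare

section Heisenberg

variable (Ω : Type u) [Field Ω] (L : Type u) [LieRing L] [LieAlgebra Ω L]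

/-- `L` is generalized Heisenberg of rank `r`: `[L, L] = Z(L)` and `dim [L, L] = r`. -/
structure IsGeneralizedHeisenberg (r : ℕ) : Prop where
  derived_eq_center : derived Ω L = LieAlgebra.center Ω L
  rank_derived : Module.rank Ω (derived Ω L) = r

/-- `L` is minimally generated, as a Lie algebra, by `d` elements: some `d` elements generate it
and no smaller finite set does. -/
structure IsMinimallyGenerated (d : ℕ) : Prop where
  exists_generators : ∃ x : Fin d → L, LieSubalgebra.lieSpan Ω L (Set.range x) = ⊤
  le_card : ∀ s : Finset L, LieSubalgebra.lieSpan Ω L (s : Set L) = ⊤ → d ≤ s.card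

/-- `L` is a freest generalized Heisenberg Lie algebra `L_d`: `d ≥ 2`, and `L` is a minimally
`d`-generated generalized Heisenberg Lie algebra of rank `d (d - 1) / 2`. -/
structure IsFreestGeneralizedHeisenberg (d : ℕ) : Prop where
  two_le : 2 ≤ d
  minimallyGenerated : IsMinimallyGenerated Ω L d
  generalizedHeisenberg : IsGeneralizedHeisenberg Ω L (d * (d - 1) / 2)

variable {L} in
/-- For `x₁, …, x_d` in `L` with `d > 4n`, the ideal generated by the `n` elements
`[x_{4k+1}, x_{4k+2}] + [x_{4k+3}, x_{4k+4}]`, `0 ≤ k < n`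
(in the code `x` is indexed from `0`). -/
def commutatorSumIdeal {d n : ℕ} (hd : 4 * n < d) (x : Fin d → L) : LieIdeal Ω L :=
  LieSubmodule.lieSpan Ω L (Set.range fun k : Fin n =>
    ⁅x ⟨4 * k, by omega⟩, x ⟨4 * k + 1, by omega⟩⁆ +
      ⁅x ⟨4 * k + 2, by omega⟩, x ⟨4 * k + 3, by omega⟩⁆)

end Heisenberg

end LieBogomolov

end

/-!
A central extension `f : H → L` induces a linear map `L ∧ L → H` sending `f a ∧ f b` to `[a, b]`
(`exists_exteriorSquare_hom`): the bracket does not depend on the lifts, and the defining relations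
of the exterior square hold for brackets in any Lie algebra. The map takes `M(L)` onto
`ker f ∩ [H, H]`. If no nonzero single bracket `[a, b]` lies in `ker f`, it kills `M₀(L)`, so that
`B(L)` maps onto a space containing `ker f ∩ [H, H]` (`exists_bogomolovMultiplier_map`).

A freest generalized Heisenberg algebra `H` generated by `x_1, …, x_d` is free nilpotent of class
two: a dimension count makes the `[x_i, x_j]`, `i < j`, a basis of `[H, H]`, which is thereby the
exterior square of the span `V` of the `x_i`, single brackets being the decomposable bivectors. The
Plücker relation of each block of four indices shows that the span `M` of the `n` elements
`[x_{4k+1}, x_{4k+2}] + [x_{4k+3}, x_{4k+4}]` contains no nonzero decomposable bivector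
(`IsFreestGeneralizedHeisenberg.lie_eq_zero_of_mem_commutatorSumIdeal`). Since `M` is `n`-dimensional
and central, the first paragraph applies to `H → H / M` and gives `dim B(H / M) ≥ n`. Finiteness of
`B(L)` holds for every finite-dimensional `L`, because the elements `m ∧ n` span `L ∧ L` linearly.
Existence of `H` is shown by the model `V ⊕ Λ² V` (`FreeClassTwo`).
-/

noncomputable section

namespace LieBogomolov

/-! ### Linear structure of the exterior square and central extensions -/

section ExteriorSquare

variable {Ω : Type u} [Field Ω] {L : Type u} [LieRing L] [LieAlgebra Ω L]

theorem wedge_rel {a b : FreeWedge Ω L} (h : Rel Ω L a b) :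
    (LieSubmodule.Quotient.mk a : ExteriorSquare Ω L) = LieSubmodule.Quotient.mk b := by
  rw [← sub_eq_zero]
  exact (LieSubmodule.Quotient.mk_eq_zero' (N := relIdeal Ω L) (m := a - b)).mpr
    (LieSubmodule.subset_lieSpan ⟨a, b, h, rfl⟩)

theorem lie_wedge_wedge (m n m' n' : L) :
    ⁅wedge Ω m n, wedge Ω m' n'⁆ = -wedge Ω ⁅n, m⁆ ⁅m', n'⁆ :=
  wedge_rel (Rel.lie_lie m n m' n')

variable (Ω L) in
/-- The wedge `m ∧ n` as a bilinear map. -/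
def wedgeBilin : L →ₗ[Ω] L →ₗ[Ω] ExteriorSquare Ω L :=
  LinearMap.mk₂ Ω (wedge Ω)
    (fun m m' n => wedge_rel (Rel.add_left m m' n))
    (fun c m n => (wedge_rel (Rel.smul_left c m n)).symm)
    (fun m n n' => wedge_rel (Rel.add_right m n n'))
    (fun c m n => (wedge_rel (Rel.smul_right c m n)).symm)

variable (Ω L) in
/-- The quotient map of a Lie algebra by an ideal, as a homomorphism of Lie algebras. -/
def quotientHom (I : LieIdeal Ω L) : L →ₗ⁅Ω⁆ L ⧸ I :=
  { I.toSubmodule.mkQ with map_lie' := rfl }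

theorem quotientHom_surjective (I : LieIdeal Ω L) : Function.Surjective (quotientHom Ω L I) :=
  I.toSubmodule.mkQ_surjective

theorem quotientHom_eq_zero {I : LieIdeal Ω L} {x : L} : quotientHom Ω L I x = 0 ↔ x ∈ I :=
  LieSubmodule.Quotient.mk_eq_zero'

variable (Ω L) in
/-- The exterior square is spanned by the elements `m ∧ n` already as a vector space: the bracket
of two of them is again, up to sign, an element of this form. -/
theorem span_wedge_eq_top :
    Submodule.span Ω (Set.range fun p : L × L => wedge Ω p.1 p.2) = ⊤ := by
  let K : LieSubalgebra Ω (ExteriorSquare Ω L) :=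
    { Submodule.span Ω (Set.range fun p : L × L => wedge Ω p.1 p.2) with
      lie_mem' := by
        intro x y hx hy
        change x ∈ Submodule.span Ω _ at hx
        change y ∈ Submodule.span Ω _ at hy
        change ⁅x, y⁆ ∈ Submodule.span Ω _
        induction hx using Submodule.span_induction with
        | zero => simp
        | add a b _ _ ha hb => rw [add_lie]; exact add_mem ha hb
        | smul c a _ ha => rw [smul_lie]; exact Submodule.smul_mem _ _ ha
        | mem a ha =>
          obtain ⟨⟨m, n⟩, rfl⟩ := ha
          induction hy using Submodule.span_induction with
          | zero => simp
          | add a b _ _ ha hb => rw [lie_add]; exact add_mem ha hb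
          | smul c a _ ha => rw [lie_smul]; exact Submodule.smul_mem _ _ ha
          | mem b hb =>
            obtain ⟨⟨m', n'⟩, rfl⟩ := hb
            rw [lie_wedge_wedge]
            exact neg_mem (Submodule.subset_span ⟨(_, _), rfl⟩) }
  have hK : ∀ p : L × L, wedge Ω p.1 p.2 ∈ K := fun p => Submodule.subset_span ⟨p, rfl⟩
  have h : K.incl.comp (FreeLieAlgebra.lift Ω fun p => (⟨_, hK p⟩ : K)) =
      quotientHom Ω _ (relIdeal Ω L) := by
    refine FreeLieAlgebra.hom_ext fun p => ?_
    rw [LieHom.comp_apply, FreeLieAlgebra.lift_of_apply]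
    rfl
  rw [eq_top_iff]
  intro w _
  obtain ⟨x, rfl⟩ := quotientHom_surjective (relIdeal Ω L) w
  rw [← h]
  exact (FreeLieAlgebra.lift Ω (fun p => (⟨_, hK p⟩ : K)) x).2

instance [FiniteDimensional Ω L] : FiniteDimensional Ω (ExteriorSquare Ω L) := by
  refine Module.Finite.of_surjective (TensorProduct.lift (wedgeBilin Ω L)) ?_
  rw [← LinearMap.range_eq_top, eq_top_iff, ← span_wedge_eq_top, Submodule.span_le]
  rintro _ ⟨p, rfl⟩
  exact ⟨p.1 ⊗ₜ p.2, TensorProduct.lift.tmul _ _⟩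

theorem exteriorSquare_hom_ext {M : Type*} [AddCommGroup M] [Module Ω M]
    {F G : ExteriorSquare Ω L →ₗ[Ω] M} (h : ∀ m n, F (wedge Ω m n) = G (wedge Ω m n)) : F = G := by
  refine LinearMap.ext_on (span_wedge_eq_top Ω L) ?_
  rintro _ ⟨p, rfl⟩
  exact h p.1 p.2

variable (Ω L) in
theorem derived_eq_span :
    (derived Ω L).toSubmodule = Submodule.span Ω {z | ∃ x y : L, ⁅x, y⁆ = z} :=
  LieAlgebra.coe_derivedSeries_one_eq Ω L

end ExteriorSquare

section CentralExtension

variable {Ω : Type u} [Field Ω] {H L : Type u} [LieRing H] [LieAlgebra Ω H] [LieRing L]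
  [LieAlgebra Ω L]

theorem lie_eq_lie_of_ker_le_center {f : H →ₗ⁅Ω⁆ L} (hc : f.ker ≤ LieAlgebra.center Ω H)
    {a a' b b' : H} (ha : f a = f a') (hb : f b = f b') : ⁅a, b⁆ = ⁅a', b'⁆ := by
  have h1 : ∀ y, ⁅y, a - a'⁆ = 0 :=
    (LieModule.mem_maxTrivSubmodule _ _ _ _).mp
      (hc ((LieHom.mem_ker).mpr (by rw [map_sub, ha, sub_self])))
  have h2 : ∀ y, ⁅y, b - b'⁆ = 0 :=
    (LieModule.mem_maxTrivSubmodule _ _ _ _).mp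
      (hc ((LieHom.mem_ker).mpr (by rw [map_sub, hb, sub_self])))
  have h3 := h1 b
  have h4 := h2 a'
  rw [lie_sub, sub_eq_zero] at h3 h4
  rw [← lie_skew a b, h3, lie_skew, h4]

/-- A central extension `f : H → L` induces a homomorphism `L ∧ L → H` with
`f a ∧ f b ↦ [a, b]`: changing the lifts does not change the bracket, and the defining relations
of `L ∧ L` hold for brackets in every Lie algebra. -/
theorem exists_exteriorSquare_hom (f : H →ₗ⁅Ω⁆ L) (hf : Function.Surjective f)
    (hc : f.ker ≤ LieAlgebra.center Ω H) :
    ∃ φ : ExteriorSquare Ω L →ₗ[Ω] H, ∀ a b : H, φ (wedge Ω (f a) (f b)) = ⁅a, b⁆ := by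
  let F : FreeWedge Ω L →ₗ⁅Ω⁆ H :=
    FreeLieAlgebra.lift Ω fun p => ⁅Function.surjInv hf p.1, Function.surjInv hf p.2⁆
  have hF : ∀ a b, F (sym Ω (f a) (f b)) = ⁅a, b⁆ := by
    intro a b
    rw [FreeLieAlgebra.lift_of_apply]
    exact lie_eq_lie_of_ker_le_center hc (Function.surjInv_eq hf _) (Function.surjInv_eq hf _)
  have hrel : ∀ a b, Rel Ω L a b → F a = F b := by
    intro a b h
    induction h with
    | smul_left c m n =>
      obtain ⟨m, rfl⟩ := hf m
      obtain ⟨n, rfl⟩ := hf n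
      rw [← map_smul f, map_smul F, hF, hF, smul_lie]
    | smul_right c m n =>
      obtain ⟨m, rfl⟩ := hf m
      obtain ⟨n, rfl⟩ := hf n
      rw [← map_smul f, map_smul F, hF, hF, lie_smul]
    | add_left m m' n =>
      obtain ⟨m, rfl⟩ := hf m
      obtain ⟨m', rfl⟩ := hf m'
      obtain ⟨n, rfl⟩ := hf n
      rw [← map_add f, map_add F, hF, hF, hF, add_lie]
    | add_right m n n' =>
      obtain ⟨m, rfl⟩ := hf m
      obtain ⟨n, rfl⟩ := hf n
      obtain ⟨n', rfl⟩ := hf n'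
      rw [← map_add f, map_add F, hF, hF, hF, lie_add]
    | lie_left m m' n =>
      obtain ⟨m, rfl⟩ := hf m
      obtain ⟨m', rfl⟩ := hf m'
      obtain ⟨n, rfl⟩ := hf n
      simp only [← LieHom.map_lie, map_sub, hF]
      exact lie_lie m m' n
    | lie_right m n n' =>
      obtain ⟨m, rfl⟩ := hf m
      obtain ⟨n, rfl⟩ := hf n
      obtain ⟨n', rfl⟩ := hf n'
      simp only [← LieHom.map_lie, map_sub, hF]
      rw [leibniz_lie m n n', ← lie_skew n m, ← lie_skew m n', lie_neg, lie_skew, neg_lie,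
        sub_neg_eq_add]
      exact add_comm _ _
    | lie_lie m n m' n' =>
      obtain ⟨m, rfl⟩ := hf m
      obtain ⟨n, rfl⟩ := hf n
      obtain ⟨m', rfl⟩ := hf m'
      obtain ⟨n', rfl⟩ := hf n'
      simp only [← LieHom.map_lie f, map_neg, LieHom.map_lie F, hF]
      rw [← lie_skew m n, neg_lie]
    | self m =>
      obtain ⟨m, rfl⟩ := hf m
      rw [hF, lie_self, map_zero]
  have hle : relIdeal Ω L ≤ F.ker := by
    refine LieSubmodule.lieSpan_le.mpr ?_
    rintro _ ⟨a, b, h, rfl⟩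
    rw [SetLike.mem_coe, LieHom.mem_ker, map_sub, hrel a b h, sub_self]
  exact ⟨(relIdeal Ω L).toSubmodule.liftQ (F : FreeWedge Ω L →ₗ[Ω] H)
    (fun _ hx => (LieHom.mem_ker).mp (hle hx)), hF⟩

/-- If the kernel of a central extension `H → L` contains no nonzero bracket `[a, b]`, then the
whole part of the kernel lying in `[H, H]` is seen by the Bogomolov multiplier of `L`. -/
theorem exists_bogomolovMultiplier_map (f : H →ₗ⁅Ω⁆ L) (hf : Function.Surjective f)
    (hc : f.ker ≤ LieAlgebra.center Ω H) (h0 : ∀ a b : H, f ⁅a, b⁆ = 0 → ⁅a, b⁆ = 0) :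
    ∃ ψ : BogomolovMultiplier Ω L →ₗ[Ω] H,
      ∀ y ∈ derived Ω H, f y = 0 → y ∈ LinearMap.range ψ := by
  obtain ⟨φ, hφ⟩ := exists_exteriorSquare_hom f hf hc
  have hker : commutingPart Ω L ≤ LinearMap.ker φ := by
    refine Submodule.span_le.mpr ?_
    rintro _ ⟨m, n, hmn, rfl⟩
    obtain ⟨a, rfl⟩ := hf m
    obtain ⟨b, rfl⟩ := hf n
    rw [SetLike.mem_coe, LinearMap.mem_ker, hφ]
    exact h0 a b (by rw [LieHom.map_lie, hmn])
  have hcomm : (f : H →ₗ[Ω] L) ∘ₗ φ =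
      (derived Ω L).toSubmodule.subtype ∘ₗ (commutatorMap Ω L : ExteriorSquare Ω L →ₗ[Ω] _) := by
    refine exteriorSquare_hom_ext fun m n => ?_
    obtain ⟨a, rfl⟩ := hf m
    obtain ⟨b, rfl⟩ := hf n
    rw [LinearMap.comp_apply, hφ]
    exact (LieHom.map_lie f a b).trans (congrArg Subtype.val (commutatorMap_wedge Ω _ _)).symm
  have hrange : (derived Ω H).toSubmodule ≤ LinearMap.range φ := by
    rw [derived_eq_span, Submodule.span_le]
    rintro _ ⟨a, b, rfl⟩
    exact ⟨_, hφ a b⟩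
  refine ⟨((commutingPart Ω L).submoduleOf (schurMultiplier Ω L)).liftQ
    (φ ∘ₗ (schurMultiplier Ω L).subtype) (fun w hw => hker hw), fun y hy hfy => ?_⟩
  obtain ⟨w, rfl⟩ := hrange hy
  have hw : w ∈ schurMultiplier Ω L :=
    (LieHom.mem_ker).mpr (Subtype.ext ((LinearMap.congr_fun hcomm w).symm.trans hfy))
  exact ⟨Submodule.Quotient.mk ⟨w, hw⟩, rfl⟩

end CentralExtension

/-! ### Lie algebras of class two and coordinates on the derived algebra -/

section ClassTwo

variable {Ω : Type u} [Field Ω] {L : Type u} [LieRing L] [LieAlgebra Ω L]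

theorem span_sup_derived_eq_top {s : Set L} (h : LieSubalgebra.lieSpan Ω L s = ⊤) :
    Submodule.span Ω s ⊔ (derived Ω L).toSubmodule = ⊤ := by
  let K : LieSubalgebra Ω L :=
    { Submodule.span Ω s ⊔ (derived Ω L).toSubmodule with
      lie_mem' := fun {x y} _ _ =>
        (le_sup_right : (derived Ω L).toSubmodule ≤ Submodule.span Ω s ⊔ _)
          (lie_mem_derived Ω x y) }
  have hK : LieSubalgebra.lieSpan Ω L s ≤ K := LieSubalgebra.lieSpan_le.mpr fun y hy =>
    (le_sup_left : Submodule.span Ω s ≤ _ ⊔ (derived Ω L).toSubmodule) (Submodule.subset_span hy)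
  rw [eq_top_iff]
  intro y _
  exact hK (h ▸ LieSubalgebra.mem_top y)

variable (Ω L) in
theorem lowerCentralSeries_two_eq_bot (h : ∀ a b c : L, ⁅a, ⁅b, c⁆⁆ = 0) :
    LieModule.lowerCentralSeries Ω L L 2 = ⊥ := by
  have h1 : LieModule.lowerCentralSeries Ω L L 1 ≤ LieAlgebra.center Ω L := by
    rw [LieModule.lowerCentralSeries_succ, LieSubmodule.lieIdeal_oper_eq_span,
      LieSubmodule.lieSpan_le]
    rintro _ ⟨x, y, rfl⟩
    exact (LieModule.mem_maxTrivSubmodule _ _ _ _).mpr fun a => h a _ _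
  rw [LieModule.lowerCentralSeries_succ, LieSubmodule.lie_eq_bot_iff]
  exact fun x _ m hm => (LieModule.mem_maxTrivSubmodule _ _ _ _).mp (h1 hm) x

theorem nilpotencyLength_eq_two (Ω : Type u) [Field Ω] {L : Type u} [LieRing L] [LieAlgebra Ω L]
    (h : ∀ a b c : L, ⁅a, ⁅b, c⁆⁆ = 0) {a b : L} (hab : ⁅a, b⁆ ≠ 0) :
    LieModule.nilpotencyLength L L = 2 := by
  rw [LieModule.nilpotencyLength_eq_succ_iff Ω]
  refine ⟨lowerCentralSeries_two_eq_bot Ω L h, fun h1 => hab ?_⟩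
  rw [LieModule.lowerCentralSeries_succ, LieSubmodule.lie_eq_bot_iff] at h1
  exact h1 a (LieSubmodule.mem_top _) b (LieSubmodule.mem_top _)

theorem lie_eq_zero_of_mem_derived (h : derived Ω L = LieAlgebra.center Ω L) (a : L) {z : L}
    (hz : z ∈ derived Ω L) : ⁅a, z⁆ = 0 :=
  (LieModule.mem_maxTrivSubmodule _ _ _ _).mp (h ▸ hz) a

theorem exists_lie_eq_lie_sum (h : derived Ω L = LieAlgebra.center Ω L) {d : ℕ} {x : Fin d → L}
    (hx : LieSubalgebra.lieSpan Ω L (Set.range x) = ⊤) (a b : L) :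
    ∃ α β : Fin d → Ω, ⁅a, b⁆ = ⁅∑ i, α i • x i, ∑ j, β j • x j⁆ := by
  have key : ∀ a : L, ∃ α : Fin d → Ω, ∃ z ∈ derived Ω L, ∑ i, α i • x i + z = a := by
    intro a
    have ha : a ∈ Submodule.span Ω (Set.range x) ⊔ (derived Ω L).toSubmodule :=
      span_sup_derived_eq_top hx ▸ Submodule.mem_top
    obtain ⟨y, hy, z, hz, rfl⟩ := Submodule.mem_sup.mp ha
    obtain ⟨α, rfl⟩ := (Submodule.mem_span_range_iff_exists_fun Ω).mp hy
    exact ⟨α, z, hz, rfl⟩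
  obtain ⟨α, z, hz, rfl⟩ := key a
  obtain ⟨β, z', hz', rfl⟩ := key b
  refine ⟨α, β, ?_⟩
  rw [lie_add, lie_eq_zero_of_mem_derived h _ hz', add_zero, add_lie, ← lie_skew z,
    lie_eq_zero_of_mem_derived h _ hz, neg_zero, add_zero]

end ClassTwo

/-- The pairs `i < j` of indices below `d`; they index the commutators `[x_i, x_j]`. -/
abbrev IndexPair (d : ℕ) : Type := {p : Fin d × Fin d // p.1 < p.2}

theorem card_indexPair (d : ℕ) : Fintype.card (IndexPair d) = d * (d - 1) / 2 := by
  let e : IndexPair d ≃ Σ j : Fin d, {i : Fin d // i < j} :=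
    { toFun := fun p => ⟨p.1.2, ⟨p.1.1, p.2⟩⟩
      invFun := fun q => ⟨(q.2.1, q.1), q.2.2⟩
      left_inv := fun _ => rfl
      right_inv := fun _ => rfl }
  have h (j : Fin d) : Fintype.card {i : Fin d // i < j} = j := by
    rw [Fintype.card_subtype, Finset.filter_gt_eq_Iio, Fin.card_Iio]
  rw [Fintype.card_congr e, Fintype.card_sigma]
  simp only [h]
  rw [Fin.sum_univ_eq_sum_range (fun j => j) d, Finset.sum_range_id]

section Freest

variable {Ω : Type u} [Field Ω] {H : Type u} [LieRing H] [LieAlgebra Ω H] {d : ℕ} {x : Fin d → H}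

theorem derived_eq_span_indexPair (h : derived Ω H = LieAlgebra.center Ω H)
    (hx : LieSubalgebra.lieSpan Ω H (Set.range x) = ⊤) :
    (derived Ω H).toSubmodule =
      Submodule.span Ω (Set.range fun p : IndexPair d => ⁅x p.1.1, x p.1.2⁆) := by
  apply le_antisymm
  · rw [derived_eq_span, Submodule.span_le]
    rintro _ ⟨a, b, rfl⟩
    obtain ⟨α, β, hαβ⟩ := exists_lie_eq_lie_sum h hx a b
    rw [SetLike.mem_coe, hαβ, sum_lie]
    refine sum_mem fun i _ => ?_
    rw [lie_sum]
    refine sum_mem fun j _ => ?_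
    rw [smul_lie, lie_smul]
    refine Submodule.smul_mem _ _ (Submodule.smul_mem _ _ ?_)
    rcases lt_trichotomy i j with hij | rfl | hij
    · exact Submodule.subset_span ⟨⟨(i, j), hij⟩, rfl⟩
    · rw [lie_self]
      exact zero_mem _
    · rw [← lie_skew]
      exact neg_mem (Submodule.subset_span ⟨⟨(j, i), hij⟩, rfl⟩)
  · rw [Submodule.span_le]
    rintro _ ⟨p, rfl⟩
    exact lie_mem_derived Ω _ _

theorem IsFreestGeneralizedHeisenberg.linearIndependent
    (hH : IsFreestGeneralizedHeisenberg Ω H d)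
    (hx : LieSubalgebra.lieSpan Ω H (Set.range x) = ⊤) :
    LinearIndependent Ω fun p : IndexPair d => ⁅x p.1.1, x p.1.2⁆ := by
  rw [linearIndependent_iff_card_eq_finrank_span, card_indexPair, Set.finrank,
    ← derived_eq_span_indexPair hH.generalizedHeisenberg.derived_eq_center hx]
  exact (Module.finrank_eq_of_rank_eq hH.generalizedHeisenberg.rank_derived).symm

theorem IsFreestGeneralizedHeisenberg.finiteDimensional
    (hH : IsFreestGeneralizedHeisenberg Ω H d)
    (hx : LieSubalgebra.lieSpan Ω H (Set.range x) = ⊤) : FiniteDimensional Ω H := by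
  have h := span_sup_derived_eq_top hx
  rw [derived_eq_span_indexPair hH.generalizedHeisenberg.derived_eq_center hx] at h
  refine ⟨?_⟩
  rw [← h]
  exact (Submodule.fg_span (Set.finite_range _)).sup (Submodule.fg_span (Set.finite_range _))

/-- Plücker coordinates on `[H, H]`, which is the exterior square of the span of the `x_i`: linear
functionals `κ · a b` on `H`, for which a single commutator has a coordinate matrix of the form
`α_a β_b - α_b β_a`. -/
theorem IsFreestGeneralizedHeisenberg.exists_coordinates
    (hH : IsFreestGeneralizedHeisenberg Ω H d)
    (hx : LieSubalgebra.lieSpan Ω H (Set.range x) = ⊤) :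
    ∃ κ : H →ₗ[Ω] Fin d → Fin d → Ω,
      (∀ i j a b, κ ⁅x i, x j⁆ a b =
        (if a = i then 1 else 0) * (if b = j then 1 else 0) -
          (if b = i then 1 else 0) * (if a = j then 1 else 0)) ∧
      ∀ h h' : H, ∃ α β : Fin d → Ω, ∀ a b, κ ⁅h, h'⁆ a b = α a * β b - α b * β a := by
  have hli := hH.linearIndependent hx
  obtain ⟨g, hg⟩ := (Finsupp.linearCombination Ω
    fun p : IndexPair d => ⁅x p.1.1, x p.1.2⁆).exists_leftInverse_of_injective
      (LinearMap.ker_eq_bot.mpr hli)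
  have hgp (p : IndexPair d) : g ⁅x p.1.1, x p.1.2⁆ = Finsupp.single p 1 := by
    have := LinearMap.congr_fun hg (Finsupp.single p 1)
    rwa [LinearMap.comp_apply, Finsupp.linearCombination_single, one_smul] at this
  let κ : H →ₗ[Ω] Fin d → Fin d → Ω := LinearMap.pi fun a => LinearMap.pi fun b =>
    if hab : a < b then Finsupp.lapply ⟨(a, b), hab⟩ ∘ₗ g
    else if hba : b < a then -(Finsupp.lapply ⟨(b, a), hba⟩ ∘ₗ g) else 0
  have hlt (p : IndexPair d) (a b : Fin d) : κ ⁅x p.1.1, x p.1.2⁆ a b =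
      (if a = p.1.1 then 1 else 0) * (if b = p.1.2 then 1 else 0) -
        (if b = p.1.1 then 1 else 0) * (if a = p.1.2 then 1 else 0) := by
    obtain ⟨⟨i, j⟩, hij⟩ := p
    simp only [κ, LinearMap.pi_apply]
    have hg' := hgp ⟨(i, j), hij⟩
    rcases lt_trichotomy a b with hab | rfl | hba
    · rw [dif_pos hab, LinearMap.comp_apply, hg', Finsupp.lapply_apply, Finsupp.single_apply]
      simp only [Subtype.mk.injEq, Prod.mk.injEq]
      grind
    · rw [dif_neg (lt_irrefl a), dif_neg (lt_irrefl a), LinearMap.zero_apply, sub_self]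
    · rw [dif_neg hba.asymm, dif_pos hba, LinearMap.neg_apply, LinearMap.comp_apply, hg',
        Finsupp.lapply_apply, Finsupp.single_apply]
      simp only [Subtype.mk.injEq, Prod.mk.injEq]
      grind
  have hκ : ∀ i j a b, κ ⁅x i, x j⁆ a b =
      (if a = i then 1 else 0) * (if b = j then 1 else 0) -
        (if b = i then 1 else 0) * (if a = j then 1 else 0) := by
    intro i j a b
    rcases lt_trichotomy i j with hij | rfl | hij
    · exact hlt ⟨(i, j), hij⟩ a b
    · rw [lie_self, map_zero, Pi.zero_apply, Pi.zero_apply]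
      ring
    · rw [← lie_skew, map_neg, Pi.neg_apply, Pi.neg_apply, hlt ⟨(j, i), hij⟩ a b]
      ring
  refine ⟨κ, hκ, fun h h' => ?_⟩
  obtain ⟨α, β, e⟩ :=
    exists_lie_eq_lie_sum hH.generalizedHeisenberg.derived_eq_center hx h h'
  refine ⟨α, β, fun a b => ?_⟩
  rw [e]
  simp only [sum_lie, lie_sum, smul_lie, lie_smul, map_sum, map_smul,
    Finset.sum_apply, Pi.smul_apply, hκ, smul_eq_mul, mul_sub, Finset.sum_sub_distrib]
  simp [Finset.sum_ite_eq]
  ring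

end Freest

/-! ### The quotient by the sums of commutators -/

section CommutatorSum

variable {Ω : Type u} [Field Ω] {H : Type u} [LieRing H] [LieAlgebra Ω H] {d n : ℕ}
  {x : Fin d → H}

variable (x) in
/-- The `k`-th generator `[x_{4k}, x_{4k+1}] + [x_{4k+2}, x_{4k+3}]` of `commutatorSumIdeal`, with
indices counted from `0`. -/
def commutatorSum (hd : 4 * n < d) (k : Fin n) : H :=
  ⁅x ⟨4 * k, by omega⟩, x ⟨4 * k + 1, by omega⟩⁆ +
    ⁅x ⟨4 * k + 2, by omega⟩, x ⟨4 * k + 3, by omega⟩⁆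

theorem commutatorSum_mem_derived (hd : 4 * n < d) (k : Fin n) :
    commutatorSum x hd k ∈ derived Ω H :=
  add_mem (lie_mem_derived Ω _ _) (lie_mem_derived Ω _ _)

/-- Commutators being central, the ideal is just the linear span of its generators. -/
theorem commutatorSumIdeal_toSubmodule (h : derived Ω H = LieAlgebra.center Ω H)
    (hd : 4 * n < d) :
    (commutatorSumIdeal Ω hd x).toSubmodule =
      Submodule.span Ω (Set.range (commutatorSum x hd)) := by
  have hle : Submodule.span Ω (Set.range (commutatorSum x hd)) ≤ (derived Ω H).toSubmodule := by
    rw [Submodule.span_le]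
    rintro _ ⟨k, rfl⟩
    exact commutatorSum_mem_derived hd k
  apply le_antisymm
  · let N : LieIdeal Ω H :=
      { Submodule.span Ω (Set.range (commutatorSum x hd)) with
        lie_mem := fun {a z} hz => by
          rw [lie_eq_zero_of_mem_derived h a (hle hz)]
          exact zero_mem (Submodule.span Ω _) }
    have hN : commutatorSumIdeal Ω hd x ≤ N := LieSubmodule.lieSpan_le.mpr Submodule.subset_span
    exact hN
  · rw [Submodule.span_le]
    exact LieSubmodule.subset_lieSpan

theorem commutatorSumIdeal_le_derived (hd : 4 * n < d) :
    commutatorSumIdeal Ω hd x ≤ derived Ω H := by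
  refine LieSubmodule.lieSpan_le.mpr ?_
  rintro _ ⟨k, rfl⟩
  exact commutatorSum_mem_derived hd k

/-- The coordinates of `∑ c_k r_k`, where `r_k = commutatorSum x hd k`, that enter the
Plücker relation on the `k`-th block of four indices. -/
theorem coordinates_sum_smul_commutatorSum (hd : 4 * n < d) {κ : H →ₗ[Ω] Fin d → Fin d → Ω}
    (hκ : ∀ i j a b, κ ⁅x i, x j⁆ a b =
        (if a = i then 1 else 0) * (if b = j then 1 else 0) -
          (if b = i then 1 else 0) * (if a = j then 1 else 0))
    (c : Fin n → Ω) (k : Fin n) :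
    κ (∑ l, c l • commutatorSum x hd l) ⟨4 * k, by omega⟩ ⟨4 * k + 1, by omega⟩ = c k ∧
    κ (∑ l, c l • commutatorSum x hd l) ⟨4 * k + 2, by omega⟩ ⟨4 * k + 3, by omega⟩ = c k ∧
    κ (∑ l, c l • commutatorSum x hd l) ⟨4 * k, by omega⟩ ⟨4 * k + 2, by omega⟩ = 0 ∧
    κ (∑ l, c l • commutatorSum x hd l) ⟨4 * k, by omega⟩ ⟨4 * k + 3, by omega⟩ = 0 := by
  simp only [map_sum, map_smul, Finset.sum_apply, Pi.smul_apply, commutatorSum, map_add,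
    Pi.add_apply, hκ, smul_eq_mul, Fin.mk.injEq]
  refine ⟨?_, ?_, ?_, ?_⟩
  · rw [Finset.sum_eq_single k]
    · simp
    · intro l _ hl
      have : (k : ℕ) ≠ l := fun h => hl (Fin.ext h.symm)
      grind
    · simp
  · rw [Finset.sum_eq_single k]
    · simp
    · intro l _ hl
      have : (k : ℕ) ≠ l := fun h => hl (Fin.ext h.symm)
      grind
    · simp
  · refine Finset.sum_eq_zero fun l _ => ?_
    grind
  · refine Finset.sum_eq_zero fun l _ => ?_
    grind

theorem IsFreestGeneralizedHeisenberg.linearIndependent_commutatorSum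
    (hH : IsFreestGeneralizedHeisenberg Ω H d)
    (hx : LieSubalgebra.lieSpan Ω H (Set.range x) = ⊤) (hd : 4 * n < d) :
    LinearIndependent Ω (commutatorSum x hd) := by
  obtain ⟨κ, hκ, -⟩ := hH.exists_coordinates hx
  refine Fintype.linearIndependent_iff.mpr fun c hc k => ?_
  rw [← (coordinates_sum_smul_commutatorSum hd hκ c k).1, hc, map_zero]
  rfl

/-- The only decomposable bivector in the span of the sums
`x_{4k} ∧ x_{4k+1} + x_{4k+2} ∧ x_{4k+3}` is zero: the Plücker relation
`p₀₁ p₂₃ - p₀₂ p₁₃ + p₀₃ p₁₂ = 0` on the `k`-th block says that `c_k ^ 2 = 0`. -/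
theorem IsFreestGeneralizedHeisenberg.lie_eq_zero_of_mem_commutatorSumIdeal
    (hH : IsFreestGeneralizedHeisenberg Ω H d)
    (hx : LieSubalgebra.lieSpan Ω H (Set.range x) = ⊤) (hd : 4 * n < d) {a b : H}
    (hab : ⁅a, b⁆ ∈ commutatorSumIdeal Ω hd x) : ⁅a, b⁆ = 0 := by
  obtain ⟨κ, hκ, hdec⟩ := hH.exists_coordinates hx
  obtain ⟨α, β, hαβ⟩ := hdec a b
  rw [← LieSubmodule.mem_toSubmodule,
    commutatorSumIdeal_toSubmodule hH.generalizedHeisenberg.derived_eq_center hd,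
    Submodule.mem_span_range_iff_exists_fun] at hab
  obtain ⟨c, hc⟩ := hab
  rw [← hc]
  refine Finset.sum_eq_zero fun k _ => ?_
  obtain ⟨h01, h23, h02, h03⟩ := coordinates_sum_smul_commutatorSum hd hκ c k
  rw [hc, hαβ] at h01 h23 h02 h03
  have hck : c k ^ 2 = 0 := by
    rw [sq]
    nth_rewrite 1 [← h01]
    rw [← h23]
    linear_combination
      (α ⟨4 * k + 1, by omega⟩ * β ⟨4 * k + 3, by omega⟩ -
        α ⟨4 * k + 3, by omega⟩ * β ⟨4 * k + 1, by omega⟩) * h02 -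
      (α ⟨4 * k + 1, by omega⟩ * β ⟨4 * k + 2, by omega⟩ -
        α ⟨4 * k + 2, by omega⟩ * β ⟨4 * k + 1, by omega⟩) * h03
  rw [pow_eq_zero_iff two_ne_zero |>.mp hck, zero_smul]

theorem IsFreestGeneralizedHeisenberg.quotient_commutatorSumIdeal
    (hH : IsFreestGeneralizedHeisenberg Ω H d)
    (hx : LieSubalgebra.lieSpan Ω H (Set.range x) = ⊤) (hd : 4 * n < d) :
    FiniteDimensional Ω (H ⧸ commutatorSumIdeal Ω hd x) ∧
    LieRing.IsNilpotent (H ⧸ commutatorSumIdeal Ω hd x) ∧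
    LieModule.nilpotencyLength (H ⧸ commutatorSumIdeal Ω hd x)
      (H ⧸ commutatorSumIdeal Ω hd x) = 2 ∧
    FiniteDimensional Ω (BogomolovMultiplier Ω (H ⧸ commutatorSumIdeal Ω hd x)) ∧
    n ≤ Module.finrank Ω (BogomolovMultiplier Ω (H ⧸ commutatorSumIdeal Ω hd x)) := by
  have hcen := hH.generalizedHeisenberg.derived_eq_center
  set M := commutatorSumIdeal Ω hd x
  let f := quotientHom Ω H M
  have hf : Function.Surjective f := quotientHom_surjective M
  have h0 : ∀ a b : H, f ⁅a, b⁆ = 0 → ⁅a, b⁆ = 0 := fun a b hab =>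
    hH.lie_eq_zero_of_mem_commutatorSumIdeal hx hd (quotientHom_eq_zero.mp hab)
  have : FiniteDimensional Ω H := hH.finiteDimensional hx
  have hfin : FiniteDimensional Ω (H ⧸ M) := Module.Finite.of_surjective (f : H →ₗ[Ω] H ⧸ M) hf
  have htwo : ∀ a b c : H ⧸ M, ⁅a, ⁅b, c⁆⁆ = 0 := by
    intro a b c
    obtain ⟨a, rfl⟩ := hf a
    obtain ⟨b, rfl⟩ := hf b
    obtain ⟨c, rfl⟩ := hf c
    rw [← LieHom.map_lie, ← LieHom.map_lie,
      lie_eq_zero_of_mem_derived hcen a (lie_mem_derived Ω b c), map_zero]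
  obtain ⟨ψ, hψ⟩ := exists_bogomolovMultiplier_map f hf
    (fun z hz => hcen ▸ commutatorSumIdeal_le_derived hd
      (quotientHom_eq_zero.mp ((LieHom.mem_ker).mp hz))) h0
  refine ⟨hfin, LieModule.IsNilpotent.mk _ (lowerCentralSeries_two_eq_bot Ω (H ⧸ M) htwo), ?_,
    inferInstance, ?_⟩
  · have h01 := (hH.linearIndependent hx).ne_zero
      ⟨(⟨0, by have := hH.two_le; omega⟩, ⟨1, by have := hH.two_le; omega⟩), by simp [Fin.lt_def]⟩
    refine nilpotencyLength_eq_two Ω htwo (a := f (x ⟨0, by have := hH.two_le; omega⟩))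
      (b := f (x ⟨1, by have := hH.two_le; omega⟩)) fun h => h01 (h0 _ _ ?_)
    rw [LieHom.map_lie, h]
  · have hle : Submodule.span Ω (Set.range (commutatorSum x hd)) ≤ LinearMap.range ψ := by
      rw [← commutatorSumIdeal_toSubmodule hcen hd]
      exact fun y hy => hψ y (commutatorSumIdeal_le_derived hd hy) (quotientHom_eq_zero.mpr hy)
    calc n = Module.finrank Ω (Submodule.span Ω (Set.range (commutatorSum x hd))) := by
          rw [finrank_span_eq_card (hH.linearIndependent_commutatorSum hx hd), Fintype.card_fin]
      _ ≤ Module.finrank Ω (LinearMap.range ψ) := Submodule.finrank_mono hle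
      _ ≤ _ := LinearMap.finrank_range_le ψ

end CommutatorSum

/-! ### The free nilpotent Lie algebra of class two -/

section Model

variable (Ω : Type u) [Field Ω] (d : ℕ)

/-- The underlying space `V ⊕ Λ² V`, `V = Ω ^ d`, of the free class-two nilpotent Lie algebra on `d`
generators; `Λ² V` is given by its Plücker coordinates. It is a `def` so that no bracket is
inherited from the product. -/
def FreeClassTwo : Type u := (Fin d → Ω) × (IndexPair d → Ω)

namespace FreeClassTwo

instance : AddCommGroup (FreeClassTwo Ω d) :=
  inferInstanceAs (AddCommGroup ((Fin d → Ω) × (IndexPair d → Ω)))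

instance : Module Ω (FreeClassTwo Ω d) :=
  inferInstanceAs (Module Ω ((Fin d → Ω) × (IndexPair d → Ω)))

variable {d}

/-- The projection onto `V`. -/
def fstₗ : FreeClassTwo Ω d →ₗ[Ω] Fin d → Ω := LinearMap.fst Ω _ _

/-- The inclusion of `Λ² V`. -/
def inrₗ : (IndexPair d → Ω) →ₗ[Ω] FreeClassTwo Ω d := LinearMap.inr Ω _ _

/-- The inclusion of `V`. -/
def inlₗ : (Fin d → Ω) →ₗ[Ω] FreeClassTwo Ω d := LinearMap.inl Ω _ _

/-- The Plücker coordinates of `v ∧ w`. -/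
def minors (v w : Fin d → Ω) (p : IndexPair d) : Ω := v p.1.1 * w p.1.2 - v p.1.2 * w p.1.1

variable {Ω}

theorem inlₗ_add_inrₗ (y : FreeClassTwo Ω d) : inlₗ Ω y.1 + inrₗ Ω y.2 = y :=
  Prod.ext (add_zero _) (zero_add _)

theorem fstₗ_inrₗ (w : IndexPair d → Ω) : fstₗ Ω (inrₗ Ω w) = 0 := rfl

theorem fstₗ_inlₗ (v : Fin d → Ω) : fstₗ Ω (inlₗ Ω v) = v := rfl

instance : Bracket (FreeClassTwo Ω d) (FreeClassTwo Ω d) :=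
  ⟨fun y z => inrₗ Ω (minors Ω (fstₗ Ω y) (fstₗ Ω z))⟩

theorem lie_def (y z : FreeClassTwo Ω d) :
    ⁅y, z⁆ = inrₗ Ω (minors Ω (fstₗ Ω y) (fstₗ Ω z)) := rfl

theorem minors_zero_right (v : Fin d → Ω) : minors Ω v 0 = 0 := by
  ext p
  simp [minors]

theorem minors_zero_left (v : Fin d → Ω) : minors Ω 0 v = 0 := by
  ext p
  simp [minors]

instance : LieRing (FreeClassTwo Ω d) where
  add_lie x y z := by
    simp only [lie_def, ← map_add]
    congr 1
    ext p
    simp only [minors, map_add, Pi.add_apply]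
    ring
  lie_add x y z := by
    simp only [lie_def, ← map_add]
    congr 1
    ext p
    simp only [minors, map_add, Pi.add_apply]
    ring
  lie_self x := by
    rw [lie_def, ← map_zero (inrₗ Ω)]
    congr 1
    ext p
    simp only [minors, Pi.zero_apply]
    ring
  leibniz_lie x y z := by
    simp only [lie_def, fstₗ_inrₗ, minors_zero_left, minors_zero_right, map_zero, add_zero]

instance : LieAlgebra Ω (FreeClassTwo Ω d) where
  lie_smul c x y := by
    simp only [lie_def, ← map_smul]
    congr 1
    ext p
    simp only [minors, map_smul, Pi.smul_apply, smul_eq_mul]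
    ring

variable (Ω) in
/-- The generators, the standard basis of `V`. -/
def gen (i : Fin d) : FreeClassTwo Ω d := inlₗ Ω (Pi.single i 1)

theorem lie_gen_gen (p : IndexPair d) :
    ⁅gen Ω p.1.1, gen Ω p.1.2⁆ = inrₗ Ω (Pi.single p 1) := by
  rw [lie_def, gen, gen, fstₗ_inlₗ, fstₗ_inlₗ]
  congr 1
  ext q
  obtain ⟨⟨i, j⟩, hij⟩ := p
  obtain ⟨⟨a, b⟩, hab⟩ := q
  simp only [minors, Pi.single_apply, Subtype.mk.injEq, Prod.mk.injEq]
  grind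

theorem inrₗ_mem_lieSpan (w : IndexPair d → Ω) :
    inrₗ Ω w ∈ LieSubalgebra.lieSpan Ω (FreeClassTwo Ω d) (Set.range (gen Ω)) := by
  rw [pi_eq_sum_univ' w, map_sum]
  refine sum_mem fun p _ => ?_
  rw [map_smul]
  refine (LieSubalgebra.lieSpan Ω (FreeClassTwo Ω d) (Set.range (gen Ω))).smul_mem _ ?_
  rw [← lie_gen_gen]
  exact LieSubalgebra.lie_mem _ (LieSubalgebra.subset_lieSpan ⟨_, rfl⟩)
    (LieSubalgebra.subset_lieSpan ⟨_, rfl⟩)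

theorem inrₗ_mem_derived (w : IndexPair d → Ω) :
    inrₗ Ω w ∈ derived Ω (FreeClassTwo Ω d) := by
  rw [pi_eq_sum_univ' w, map_sum]
  refine sum_mem fun p _ => ?_
  rw [map_smul, ← lie_gen_gen]
  exact (derived Ω (FreeClassTwo Ω d)).smul_mem _ (lie_mem_derived Ω _ _)

variable (Ω d) in
theorem derived_toSubmodule :
    (derived Ω (FreeClassTwo Ω d)).toSubmodule = LinearMap.range (inrₗ Ω) := by
  apply le_antisymm
  · rw [derived_eq_span, Submodule.span_le]
    rintro _ ⟨y, z, rfl⟩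
    exact ⟨_, rfl⟩
  · rintro _ ⟨w, rfl⟩
    exact inrₗ_mem_derived w

theorem fstₗ_eq_zero_of_mem_center (hd : 2 ≤ d) {y : FreeClassTwo Ω d}
    (hy : y ∈ LieAlgebra.center Ω (FreeClassTwo Ω d)) : fstₗ Ω y = 0 := by
  have h (v : Fin d → Ω) (p : IndexPair d) :
      v p.1.1 * fstₗ Ω y p.1.2 - v p.1.2 * fstₗ Ω y p.1.1 = 0 :=
    congrFun (congrArg Prod.snd ((LieModule.mem_maxTrivSubmodule _ _ _ _).mp hy (inlₗ Ω v))) p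
  ext i
  -- With an index `j ≠ i` at hand, the bracket with the generator `j` detects the `i`-th coordinate.
  have : Nontrivial (Fin d) := Fin.nontrivial_iff_two_le.mpr hd
  obtain ⟨j, hj⟩ := exists_ne i
  rcases lt_or_gt_of_ne hj with hji | hij
  · simpa [hj.symm] using h (Pi.single j 1) ⟨(j, i), hji⟩
  · simpa [hj.symm] using h (Pi.single j 1) ⟨(i, j), hij⟩

variable (Ω) in
theorem derived_eq_center (hd : 2 ≤ d) :
    derived Ω (FreeClassTwo Ω d) = LieAlgebra.center Ω (FreeClassTwo Ω d) := by
  apply le_antisymm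
  · intro z hz
    rw [← LieSubmodule.mem_toSubmodule, derived_toSubmodule] at hz
    obtain ⟨w, rfl⟩ := hz
    refine (LieModule.mem_maxTrivSubmodule _ _ _ _).mpr fun y => ?_
    rw [lie_def, fstₗ_inrₗ, minors_zero_right, map_zero]
  · intro y hy
    have h := fstₗ_eq_zero_of_mem_center hd hy
    have hy' : inrₗ Ω y.2 = y := Prod.ext h.symm rfl
    rw [← hy']
    exact inrₗ_mem_derived _

variable (Ω d) in
theorem rank_derived :
    Module.rank Ω (derived Ω (FreeClassTwo Ω d)) = (d * (d - 1) / 2 : ℕ) := by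
  change Module.rank Ω (derived Ω (FreeClassTwo Ω d)).toSubmodule = _
  rw [derived_toSubmodule, ← (LinearEquiv.ofInjective (inrₗ Ω) LinearMap.inr_injective).rank_eq,
    rank_fun', card_indexPair]

variable (Ω d) in
theorem lieSpan_gen : LieSubalgebra.lieSpan Ω (FreeClassTwo Ω d) (Set.range (gen Ω)) = ⊤ := by
  rw [eq_top_iff]
  intro y _
  rw [← inlₗ_add_inrₗ y, pi_eq_sum_univ' y.1, map_sum]
  refine add_mem (sum_mem fun i _ => ?_) (inrₗ_mem_lieSpan _)
  rw [map_smul]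
  exact (LieSubalgebra.lieSpan Ω (FreeClassTwo Ω d) (Set.range (gen Ω))).smul_mem _
    (LieSubalgebra.subset_lieSpan ⟨i, rfl⟩)

theorem le_card_of_lieSpan_eq_top (s : Finset (FreeClassTwo Ω d))
    (hs : LieSubalgebra.lieSpan Ω (FreeClassTwo Ω d) (s : Set (FreeClassTwo Ω d)) = ⊤) :
    d ≤ s.card := by
  classical
  -- Modulo `[L, L]`, a generating set spans the `d`-dimensional space `V`.
  have h := congrArg (Submodule.map (fstₗ Ω)) (span_sup_derived_eq_top hs)
  rw [Submodule.map_sup, derived_toSubmodule, ← LinearMap.range_comp,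
    show fstₗ Ω ∘ₗ inrₗ Ω = (0 : (IndexPair d → Ω) →ₗ[Ω] Fin d → Ω) from rfl, LinearMap.range_zero,
    sup_bot_eq, Submodule.map_top, LinearMap.range_eq_top.mpr Prod.fst_surjective,
    Submodule.map_span, ← Finset.coe_image] at h
  calc d = Module.finrank Ω (Submodule.span Ω (s.image (fstₗ Ω) : Set (Fin d → Ω))) := by
        rw [h, finrank_top, Module.finrank_fin_fun]
    _ ≤ (s.image (fstₗ Ω)).card := finrank_span_finset_le_card _
    _ ≤ s.card := Finset.card_image_le

variable (Ω) in
theorem isFreestGeneralizedHeisenberg (hd : 2 ≤ d) :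
    IsFreestGeneralizedHeisenberg Ω (FreeClassTwo Ω d) d where
  two_le := hd
  minimallyGenerated := ⟨⟨gen Ω, lieSpan_gen Ω d⟩, le_card_of_lieSpan_eq_top⟩
  generalizedHeisenberg := ⟨derived_eq_center Ω hd, rank_derived Ω d⟩

end FreeClassTwo

end Model

end LieBogomolov

end

theorem theorem1p6 (Ω : Type u) [Field Ω] (n : ℕ) (hn : 1 ≤ n) :
    (∃ (L : Type u) (_ : LieRing L) (_ : LieAlgebra Ω L),
      FiniteDimensional Ω L ∧
      LieRing.IsNilpotent L ∧ LieModule.nilpotencyLength L L = 2 ∧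
      FiniteDimensional Ω (LieBogomolov.BogomolovMultiplier Ω L) ∧
      n ≤ Module.finrank Ω (LieBogomolov.BogomolovMultiplier Ω L)) ∧
    (∀ (d : ℕ) (hd : 4 * n < d),
      (∃ (H : Type u) (_ : LieRing H) (_ : LieAlgebra Ω H),
        LieBogomolov.IsFreestGeneralizedHeisenberg Ω H d) ∧
      ∀ (H : Type u) [LieRing H] [LieAlgebra Ω H],
        LieBogomolov.IsFreestGeneralizedHeisenberg Ω H d →
        ∀ x : Fin d → H, LieSubalgebra.lieSpan Ω H (Set.range x) = ⊤ →
          FiniteDimensional Ω (H ⧸ LieBogomolov.commutatorSumIdeal Ω hd x) ∧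
          LieRing.IsNilpotent (H ⧸ LieBogomolov.commutatorSumIdeal Ω hd x) ∧
          LieModule.nilpotencyLength (H ⧸ LieBogomolov.commutatorSumIdeal Ω hd x)
            (H ⧸ LieBogomolov.commutatorSumIdeal Ω hd x) = 2 ∧
          FiniteDimensional Ω (LieBogomolov.BogomolovMultiplier Ω
            (H ⧸ LieBogomolov.commutatorSumIdeal Ω hd x)) ∧
          n ≤ Module.finrank Ω (LieBogomolov.BogomolovMultiplier Ω
            (H ⧸ LieBogomolov.commutatorSumIdeal Ω hd x))) := by
  have hquot : ∀ (d : ℕ) (hd : 4 * n < d) (H : Type u) [LieRing H] [LieAlgebra Ω H],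
      LieBogomolov.IsFreestGeneralizedHeisenberg Ω H d →
      ∀ x : Fin d → H, LieSubalgebra.lieSpan Ω H (Set.range x) = ⊤ → _ :=
    fun d hd H _ _ hH x hx => hH.quotient_commutatorSumIdeal hx hd
  refine ⟨?_, fun d hd => ⟨⟨LieBogomolov.FreeClassTwo Ω d, inferInstance, inferInstance,
    LieBogomolov.FreeClassTwo.isFreestGeneralizedHeisenberg Ω (by omega)⟩, hquot d hd⟩⟩
  exact ⟨_, inferInstance, inferInstance, hquot _ (Nat.lt_succ_self (4 * n)) _
    (LieBogomolov.FreeClassTwo.isFreestGeneralizedHeisenberg Ω (by omega)) _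
    (LieBogomolov.FreeClassTwo.lieSpan_gen Ω (4 * n + 1))⟩
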